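/- Let $X_n=\{x_1,\dots,x_n\}$. A *decision tree* over $X_n$ is a binary tree whose internal nodes are labelled by subsets of $X_n$ (questions "$x\in S$?", with a Yes-branch and a No-branch) and whose leaves are labelled by distinct elements of $X_n$. It is *valid* for a probability distribution $\mu$ on $X_n$ if its leaf labels are exactly the elements of the support of $\mu$ and, for each $x$ in the support, answering the questions truthfully for $x$ leads to the leaf labelled $x$; its *cost* on $\mu$ is $T(\mu)=\sum_i \mu_i\,T(x_i)$, where $T(x_i)$ is the number of questions asked when the unknown element is $x_i$. For a set $\mathcal Q\subseteq 2^{X_n}$ of allowed questions let $c(\mathcal Q,\mu)$ be the minimal cost of a decision tree valid for $\mu$ all of whose questions lie in $\mathcal Q$ ($+\infty$ if there is none), and let $\mathrm{Opt}(\mu)=c(2^{X_n},\mu)$ (the cost of a Huffman code). Let $u_{\mathrm{Huf}}(n,r)$ be the minimal cardinality of a set $\mathcal Q\subseteq 2^{X_n}$ such that $\sup_\mu\,\bigl(c(\mathcal Q,\mu)-\mathrm{Opt}(\mu)\bigr)\le r$, the supremum being over all probability distributions $\mu$ on $X_n$. Then $$u_{\mathrm{Huf}}(n,0)\le 1.25^{\,n+o(n)}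 .$$ That is, there is a function $f:\mathbb N\to\mathbb R$ with $f(n)=o(n)$ as $n\to\infty$ such that for every $n$ we have $u_{\mathrm{Huf}}(n,0)\le 1.25^{\,n+f(n)}$, and there is a set $\mathcal Q\subseteq 2^{X_n}$ of at most $1.25^{\,n+f(n)}$ questions such that every probability distribution $\mu$ on $X_n$ has a valid decision tree that uses only questions from $\mathcal Q$ and has cost exactly $\mathrm{Opt}(\mu)$. -/

import Mathlib

namespace TwentyQuestions

/-- Binary trees whose internal nodes are labelled by questions (subsets of `X`) and whose leaves
are labelled by elements of `X`. In `node S yes no`, the subtree `yes` is entered when the unknown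
element belongs to `S`, and `no` when it does not. -/
inductive DecisionTree (X : Type) : Type
  | leaf (x : X) : DecisionTree X
  | node (S : Finset X) (yes no : DecisionTree X) : DecisionTree X

namespace DecisionTree

variable {X : Type}

/-- The list of the leaf labels, one entry for each leaf. -/
def leaves : DecisionTree X → List X
  | leaf x => [x]
  | node _ yes no => yes.leaves ++ no.leaves

/-- All questions of the tree belong to the set `Q` of allowed questions. -/
def Uses (Q : Finset (Finset X)) : DecisionTree X → Prop
  | leaf _ => True
  | node S yes no => S ∈ Q ∧ yes.Uses Q ∧ no.Uses Q

variable [DecidableEq X]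

/-- The label of the leaf that is reached when the unknown element is `x`. -/
def output : DecisionTree X → X → X
  | leaf y, _ => y
  | node S yes no, x => if x ∈ S then yes.output x else no.output x

/-- The number of questions asked when the unknown element is `x`. When the leaf reached is the one
labelled `x`, this is the depth of that leaf. -/
def depth : DecisionTree X → X → ℕ
  | leaf _, _ => 0
  | node S yes no, x => (if x ∈ S then yes.depth x else no.depth x) + 1

/-- The tree `T` is valid for `μ`: its leaves carry distinct labels, the labels are exactly the
elements of the support of `μ`, and each element `x` of the support is revealed by `T`, that is,
the true answers for `x` lead to the leaf labelled `x`. -/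
structure Valid (T : DecisionTree X) (μ : X → ℝ) : Prop where
  nodup : T.leaves.Nodup
  mem_leaves_iff : ∀ x, x ∈ T.leaves ↔ μ x ≠ 0
  output_eq : ∀ x, μ x ≠ 0 → T.output x = x

/-- The cost of `T` on `μ`: the average number of questions asked. -/
def cost [Fintype X] (T : DecisionTree X) (μ : X → ℝ) : ℝ :=
  ∑ x, μ x * (T.depth x : ℝ)

end DecisionTree

section

variable {X : Type} [DecidableEq X] [Fintype X]

/-- The minimal cost of a decision tree using `Q` that is valid for `μ`
(`⊤` if there is no such tree). -/
noncomputable def optCost (Q : Finset (Finset X)) (μ : X → ℝ) : EReal :=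
  ⨅ (T : DecisionTree X) (_ : T.Uses Q) (_ : T.Valid μ), ((T.cost μ : ℝ) : EReal)

/-- The cost of an optimal unrestricted decision tree (the Huffman optimum). -/
noncomputable def opt (μ : X → ℝ) : EReal :=
  optCost (Finset.univ : Finset (Finset X)) μ

/-- The prolixity of `Q`: the supremum, over all probability distributions `μ` on `X`, of the
difference between the best cost achievable with questions from `Q` and the optimum. -/
noncomputable def prolixity (Q : Finset (Finset X)) : EReal :=
  ⨆ μ ∈ stdSimplex ℝ X, (optCost Q μ - opt μ)

end

/-- The minimal cardinality of a set of questions over an `n`-element set whose prolixity is at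
most `r`. -/
noncomputable def uHuf (n : ℕ) (r : ℝ) : ℕ :=
  sInf {k : ℕ | ∃ Q : Finset (Finset (Fin n)), Q.card = k ∧ prolixity Q ≤ (r : EReal)}

end TwentyQuestions

/-! The depths of a valid tree satisfy Kraft's equality, so they define a dyadic distribution on its
leaves, and the cost depends only on them. If every dyadic distribution on at least two points has a
question in `Q` of mass exactly 1/2 (`IsDyadicHitter`), recursive halving rebuilds a tree with the
same depths, so `Q` attains every optimum (`IsDyadicHitter.exists_optimal`).

Small hitters come from a covering argument. A set `A` gets weight `4 ^ (-|A|)`, of total `(5/4) ^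
n`; up to scaling, `A` is random and contains each point with probability 1/5. By
`le_splitWeight_half` the sets halving a given dyadic distribution weigh at least `exp (-O(√n log
n))`. There are only `exp (O(n ^ 2))` distributions to hit, so greedy choice (`exists_cover`) needs
`1.25 ^ (n + o(n))` questions.

For the lower bound, about half of the leaves are selected on each level of the tree: `m.choose (m /
2)` almost cancels `4 ^ (-m / 2)`, so a level costs a factor polynomial in `n`. To pay for few
levels, the selection stops at a level of depth `O(√n)` with `O(√n)` internal nodes
(`exists_narrow_level`), whose leaves bring the mass to exactly 1/2. -/

namespace TwentyQuestions

/-! ### Decision trees, Kraft's equality and dyadic hitters. -/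

section Tree

namespace DecisionTree

variable {X : Type}

theorem leaves_length_pos (T : DecisionTree X) : 0 < T.leaves.length := by
  induction T with
  | leaf y => simp [leaves]
  | node S yes no ihy ihn => simp only [leaves, List.length_append]; omega

variable [DecidableEq X]

theorem output_mem_leaves (T : DecisionTree X) (x : X) : T.output x ∈ T.leaves := by
  induction T with
  | leaf y => simp [output, leaves]
  | node S yes no ihy ihn =>
    simp only [output, leaves, List.mem_append]
    split_ifs
    · exact Or.inl ihy
    · exact Or.inr ihn

theorem depth_lt_leaves_length (T : DecisionTree X) (x : X) : T.depth x < T.leaves.length := by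
  induction T with
  | leaf y => simp [depth, leaves]
  | node S yes no ihy ihn =>
    have := yes.leaves_length_pos
    have := no.leaves_length_pos
    simp only [depth, leaves, List.length_append]
    split_ifs <;> omega

/-- Kraft's equality for decision trees that reveal each of their leaf labels. -/
theorem kraft_eq (T : DecisionTree X) (hnd : T.leaves.Nodup)
    (hout : ∀ x ∈ T.leaves, T.output x = x) :
    ∑ x ∈ T.leaves.toFinset, (1 / 2 : ℝ) ^ T.depth x = 1 := by
  induction T with
  | leaf y => simp [leaves, depth]
  | node S yes no ihy ihn =>
    simp only [leaves] at hnd hout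
    obtain ⟨hy, hn, hdisj⟩ := List.nodup_append'.1 hnd
    -- Otherwise truthful answers would lead `x` into the other subtree, whose labels are different.
    have memS : ∀ x ∈ yes.leaves, x ∈ S := by
      intro x hx
      by_contra hxS
      have h := hout x (List.mem_append_left _ hx)
      simp only [output, if_neg hxS] at h
      exact hdisj hx (h ▸ no.output_mem_leaves x)
    have notMemS : ∀ x ∈ no.leaves, x ∉ S := by
      intro x hx hxS
      have h := hout x (List.mem_append_right _ hx)
      simp only [output, if_pos hxS] at h
      exact hdisj (h ▸ yes.output_mem_leaves x) hx
    have h1 := ihy hy fun x hx => by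
      simpa [output, memS x hx] using hout x (List.mem_append_left _ hx)
    have h2 := ihn hn fun x hx => by
      simpa [output, notMemS x hx] using hout x (List.mem_append_right _ hx)
    simp only [leaves, List.toFinset_append]
    rw [Finset.sum_union (by
      rw [Finset.disjoint_left]
      intro x hx hx'
      exact hdisj (List.mem_toFinset.1 hx) (List.mem_toFinset.1 hx'))]
    have e1 : ∑ x ∈ yes.leaves.toFinset, (1 / 2 : ℝ) ^ (node S yes no).depth x = 1 / 2 := by
      refine Eq.trans ?_ ((congrArg (1 / 2 * ·) h1).trans (mul_one (1 / 2 : ℝ)))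
      rw [Finset.mul_sum]
      refine Finset.sum_congr rfl fun x hx => ?_
      simp only [depth, if_pos (memS x (List.mem_toFinset.1 hx))]
      ring
    have e2 : ∑ x ∈ no.leaves.toFinset, (1 / 2 : ℝ) ^ (node S yes no).depth x = 1 / 2 := by
      refine Eq.trans ?_ ((congrArg (1 / 2 * ·) h2).trans (mul_one (1 / 2 : ℝ)))
      rw [Finset.mul_sum]
      refine Finset.sum_congr rfl fun x hx => ?_
      simp only [depth, if_neg (notMemS x (List.mem_toFinset.1 hx))]
      ring
    rw [e1, e2]
    norm_num

end DecisionTree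

variable {X : Type}

theorem sum_half_pow_pred {S : Finset X} {d : X → ℕ} (h0 : ∀ x ∈ S, d x ≠ 0)
    (hS : ∑ x ∈ S, (1 / 2 : ℝ) ^ d x = 1 / 2) : ∑ x ∈ S, (1 / 2 : ℝ) ^ (d x - 1) = 1 := by
  have : ∑ x ∈ S, (1 / 2 : ℝ) ^ (d x - 1) = ∑ x ∈ S, 2 * (1 / 2 : ℝ) ^ d x := by
    refine Finset.sum_congr rfl fun x hx => ?_
    obtain ⟨k, hk⟩ := Nat.exists_eq_succ_of_ne_zero (h0 x hx)
    rw [hk, Nat.succ_sub_one, pow_succ]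
    ring
  rw [this, ← Finset.mul_sum, hS]
  norm_num

variable [DecidableEq X]

/-- `Q` contains, for each dyadic distribution `x ↦ 2 ^ (-d x)` on a set `S` of at least two
elements with exponents less than `N`, a question of probability one half. -/
def IsDyadicHitter (Q : Finset (Finset X)) (N : ℕ) : Prop :=
  ∀ (S : Finset X) (d : X → ℕ), (∀ x ∈ S, d x < N) → ∑ x ∈ S, (1 / 2 : ℝ) ^ d x = 1 →
    1 < S.card → ∃ A ∈ Q, ∑ x ∈ S with x ∈ A, (1 / 2 : ℝ) ^ d x = 1 / 2

theorem exponent_ne_zero {S : Finset X} {d : X → ℕ} (hd : ∑ x ∈ S, (1 / 2 : ℝ) ^ d x = 1)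
    (hS : 1 < S.card) {x : X} (hx : x ∈ S) : d x ≠ 0 := by
  intro h0
  obtain ⟨y, hy, hyx⟩ := Finset.exists_mem_ne hS x
  have h : ∑ z ∈ {x, y}, (1 / 2 : ℝ) ^ d z ≤ ∑ z ∈ S, (1 / 2 : ℝ) ^ d z :=
    Finset.sum_le_sum_of_subset_of_nonneg (by
      intro z hz
      rcases Finset.mem_insert.1 hz with rfl | hz
      · exact hx
      · exact Finset.mem_singleton.1 hz ▸ hy) fun _ _ _ => by positivity
  rw [Finset.sum_pair hyx.symm, hd, h0, pow_zero] at h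
  have : (0 : ℝ) < (1 / 2) ^ d y := by positivity
  linarith

/-- A dyadic hitter realizes every system of depths satisfying Kraft's equality. -/
theorem IsDyadicHitter.exists_tree {Q : Finset (Finset X)} {N : ℕ} (hQ : IsDyadicHitter Q N)
    (S : Finset X) (d : X → ℕ) (hN : ∀ x ∈ S, d x < N)
    (hd : ∑ x ∈ S, (1 / 2 : ℝ) ^ d x = 1) :
    ∃ T : DecisionTree X, T.Uses Q ∧ T.leaves.Nodup ∧ (∀ x, x ∈ T.leaves ↔ x ∈ S) ∧
      ∀ x ∈ S, T.output x = x ∧ T.depth x = d x := by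
  induction hc : S.card using Nat.strong_induction_on generalizing S d with
  | _ c ih =>
    have hne : S.Nonempty := by
      rw [Finset.nonempty_iff_ne_empty]
      rintro rfl
      simp at hd
    by_cases hS : 1 < S.card
    · obtain ⟨A, hA, hAs⟩ := hQ S d hN hd hS
      have h0 : ∀ x ∈ S, d x ≠ 0 := fun x hx => exponent_ne_zero hd hS hx
      have hsum := Finset.sum_filter_add_sum_filter_not S (· ∈ A) fun x => (1 / 2 : ℝ) ^ d x
      have hBs : ∑ x ∈ S with x ∉ A, (1 / 2 : ℝ) ^ d x = 1 / 2 := by linarith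
      have hcard := Finset.card_filter_add_card_filter_not (s := S) (· ∈ A)
      have pos : ∀ B : Finset X, ∑ x ∈ B, (1 / 2 : ℝ) ^ d x = 1 / 2 → 0 < B.card := by
        intro B hB
        rw [Finset.card_pos, Finset.nonempty_iff_ne_empty]
        rintro rfl
        norm_num at hB
      have pA := pos _ hAs
      have pB := pos _ hBs
      -- Conditioning on either answer doubles the masses, so all exponents drop by one and Kraft's
      -- equality persists.
      obtain ⟨Ty, uy, ny, my, oy⟩ := ih _ (by omega) (S.filter (· ∈ A)) (fun x => d x - 1)
        (fun x hx => (Nat.sub_le _ _).trans_lt (hN x (Finset.mem_filter.1 hx).1))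
        (sum_half_pow_pred (fun x hx => h0 x (Finset.mem_filter.1 hx).1) hAs) rfl
      obtain ⟨Tn, un, nn, mn, on⟩ := ih _ (by omega) (S.filter (· ∉ A)) (fun x => d x - 1)
        (fun x hx => (Nat.sub_le _ _).trans_lt (hN x (Finset.mem_filter.1 hx).1))
        (sum_half_pow_pred (fun x hx => h0 x (Finset.mem_filter.1 hx).1) hBs) rfl
      refine ⟨.node A Ty Tn, ⟨hA, uy, un⟩, ?_, ?_, ?_⟩
      · refine List.nodup_append'.2 ⟨ny, nn, fun x hx hx' => ?_⟩
        exact (Finset.mem_filter.1 ((mn x).1 hx')).2 (Finset.mem_filter.1 ((my x).1 hx)).2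
      · intro x
        simp only [DecisionTree.leaves, List.mem_append, my, mn, Finset.mem_filter]
        tauto
      · intro x hx
        have := h0 x hx
        by_cases hxA : x ∈ A
        · have := oy x (Finset.mem_filter.2 ⟨hx, hxA⟩)
          simp only [DecisionTree.output, DecisionTree.depth, if_pos hxA]
          exact ⟨this.1, by omega⟩
        · have := on x (Finset.mem_filter.2 ⟨hx, hxA⟩)
          simp only [DecisionTree.output, DecisionTree.depth, if_neg hxA]
          exact ⟨this.1, by omega⟩
    · have h1 : S.card = 1 := by have := hne.card_pos; omega
      obtain ⟨a, rfl⟩ := Finset.card_eq_one.1 h1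
      refine ⟨.leaf a, trivial, by simp [DecisionTree.leaves], by simp [DecisionTree.leaves], ?_⟩
      intro x hx
      rw [Finset.mem_singleton] at hx
      subst hx
      rw [Finset.sum_singleton] at hd
      refine ⟨rfl, ?_⟩
      by_contra h
      exact (pow_lt_one₀ (by norm_num : (0 : ℝ) ≤ 1 / 2) (by norm_num)
        fun h' => h (by simp [DecisionTree.depth, h'])).ne hd

theorem exists_revealing_tree {S : Finset X} (hS : S.Nonempty) :
    ∃ T : DecisionTree X, T.leaves.Nodup ∧ (∀ x, x ∈ T.leaves ↔ x ∈ S) ∧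
      ∀ x ∈ S, T.output x = x := by
  induction hS using Finset.Nonempty.cons_induction with
  | singleton a =>
    exact ⟨.leaf a, by simp [DecisionTree.leaves], by simp [DecisionTree.leaves],
      fun x hx => (Finset.mem_singleton.1 hx).symm⟩
  | cons a s ha _ ih =>
    obtain ⟨T, hnd, hm, ho⟩ := ih
    refine ⟨.node {a} (.leaf a) T, ?_, ?_, ?_⟩
    · simpa [DecisionTree.leaves, hnd, hm] using ha
    · simp [DecisionTree.leaves, hm]
    · intro x hx
      by_cases hxa : x = a
      · simp [DecisionTree.output, hxa]
      · simpa [DecisionTree.output, hxa] using ho x (by simpa [hxa] using hx)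

variable [Fintype X]

theorem DecisionTree.Valid.leaves_toFinset {T : DecisionTree X} {μ : X → ℝ} (hT : T.Valid μ) :
    T.leaves.toFinset = Finset.univ.filter (μ · ≠ 0) := by
  ext x
  simp [hT.mem_leaves_iff]

theorem DecisionTree.Valid.depth_lt {T : DecisionTree X} {μ : X → ℝ} (hT : T.Valid μ) (x : X) :
    T.depth x < Fintype.card X := by
  refine (T.depth_lt_leaves_length x).trans_le ?_
  rw [← List.toFinset_card_of_nodup hT.nodup]
  exact Finset.card_le_univ _

/-- A dyadic hitter imitates each valid tree at the same cost. -/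
theorem IsDyadicHitter.exists_valid_cost_eq {Q : Finset (Finset X)}
    (hQ : IsDyadicHitter Q (Fintype.card X)) {μ : X → ℝ} {T : DecisionTree X} (hT : T.Valid μ) :
    ∃ T' : DecisionTree X, T'.Uses Q ∧ T'.Valid μ ∧ T'.cost μ = T.cost μ := by
  have hk := T.kraft_eq hT.nodup fun x hx => hT.output_eq x ((hT.mem_leaves_iff x).1 hx)
  rw [hT.leaves_toFinset] at hk
  obtain ⟨T', hu, hnd, hm, ho⟩ := hQ.exists_tree _ _ (fun x _ => hT.depth_lt x) hk
  refine ⟨T', hu, ⟨hnd, fun x => by simp [hm], fun x hx => (ho x (by simp [hx])).1⟩, ?_⟩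
  refine Finset.sum_congr rfl fun x _ => ?_
  by_cases hx : μ x = 0
  · simp [hx]
  · rw [(ho x (by simp [hx])).2]

theorem DecisionTree.uses_univ {X : Type} [Fintype X] (T : DecisionTree X) : T.Uses Finset.univ := by
  induction T with
  | leaf y => trivial
  | node S yes no ihy ihn => exact ⟨Finset.mem_univ _, ihy, ihn⟩

theorem exists_valid {μ : X → ℝ} (hμ : (Finset.univ.filter (μ · ≠ 0)).Nonempty) :
    ∃ T : DecisionTree X, T.Valid μ := by
  obtain ⟨T, hnd, hm, ho⟩ := exists_revealing_tree hμ
  exact ⟨T, hnd, fun x => by simp [hm], fun x hx => ho x (by simp [hx])⟩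

/-- With a dyadic hitter every distribution has an optimal tree. -/
theorem IsDyadicHitter.exists_optimal {Q : Finset (Finset X)}
    (hQ : IsDyadicHitter Q (Fintype.card X)) {μ : X → ℝ} (hμ : μ ∈ stdSimplex ℝ X) :
    ∃ T : DecisionTree X, T.Uses Q ∧ T.Valid μ ∧ ((T.cost μ : ℝ) : EReal) = opt μ := by
  have hne : (Finset.univ.filter (μ · ≠ 0)).Nonempty := by
    rw [Finset.nonempty_iff_ne_empty]
    intro h
    have h0 : ∀ x, μ x = 0 := fun x => by
      by_contra hx
      exact Finset.notMem_empty x (h ▸ Finset.mem_filter.2 ⟨Finset.mem_univ x, hx⟩)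
    have := hμ.2
    simp [h0] at this
  obtain ⟨T₀, hT₀⟩ := exists_valid hne
  let C : Set ℝ := {c | ∃ T : DecisionTree X, T.Valid μ ∧ T.cost μ = c}
  -- Depths are bounded by the number of leaves, so only finitely many costs occur and the infimum
  -- is attained.
  have hfin : C.Finite := by
    refine (Set.finite_range fun g : X → Fin (Fintype.card X) =>
      ∑ x, μ x * ((g x : ℕ) : ℝ)).subset ?_
    rintro c ⟨T, hT, rfl⟩
    exact ⟨fun x => ⟨T.depth x, hT.depth_lt x⟩, rfl⟩
  obtain ⟨c, ⟨T₁, hT₁, rfl⟩, hmin⟩ := Set.exists_min_image C id hfin ⟨_, T₀, hT₀, rfl⟩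
  obtain ⟨T, hu, hv, hc⟩ := hQ.exists_valid_cost_eq hT₁
  refine ⟨T, hu, hv, le_antisymm ?_ ?_⟩
  · refine le_iInf fun T' => le_iInf fun _ => le_iInf fun hT' => ?_
    rw [hc]
    exact EReal.coe_le_coe_iff.2 (hmin _ ⟨T', hT', rfl⟩)
  · exact iInf_le_of_le T (iInf_le_of_le (T.uses_univ) (iInf_le _ hv))

theorem IsDyadicHitter.prolixity_nonpos {Q : Finset (Finset X)}
    (hQ : IsDyadicHitter Q (Fintype.card X)) : prolixity Q ≤ 0 := by
  refine iSup₂_le fun μ hμ => ?_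
  obtain ⟨T, hu, hv, hc⟩ := hQ.exists_optimal hμ
  have h : optCost Q μ ≤ opt μ := hc ▸ iInf_le_of_le T (iInf_le_of_le hu (iInf_le _ hv))
  rw [← hc] at h ⊢
  exact EReal.sub_nonpos.2 h

end Tree

/-! ### Greedy covering. -/

/-- If each element of `P` is hit by a proportion `q` of the weight, then greedily chosen `k`
elements of `U` leave at most a proportion `(1 - q) ^ k` of `P` unhit. -/
theorem exists_cover {α β : Type*} [DecidableEq β] (U : Finset β) (hU : U.Nonempty) (w : β → ℝ)
    (hw : ∀ b ∈ U, 0 < w b) (P : Finset α) (hit : α → β → Prop) [∀ a b, Decidable (hit a b)]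
    {q : ℝ} (hq : q ≤ 1)
    (h : ∀ p ∈ P, q * ∑ b ∈ U, w b ≤ ∑ b ∈ U with hit p b, w b) (k : ℕ) :
    ∃ Q : Finset β, Q.card ≤ k ∧
      ((P.filter fun p => ∀ b ∈ Q, ¬ hit p b).card : ℝ) ≤ (1 - q) ^ k * P.card := by
  induction k with
  | zero => exact ⟨∅, by simp⟩
  | succ k ih =>
    obtain ⟨Q, hQk, hQ⟩ := ih
    set P' := P.filter fun p => ∀ b ∈ Q, ¬ hit p b with hP'
    -- Double counting: on `w`-weighted average, an element of `U` hits a proportion at least `q` of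
    -- the unhit part `P'`.
    obtain ⟨b, hb, hbP⟩ : ∃ b ∈ U, w b * (q * P'.card) ≤
        w b * ((P'.filter fun p => hit p b).card : ℝ) := by
      refine Finset.exists_le_of_sum_le hU ?_
      calc ∑ b ∈ U, w b * (q * P'.card) = ∑ p ∈ P', q * ∑ b ∈ U, w b := by
            rw [← Finset.sum_mul, Finset.sum_const, nsmul_eq_mul]; ring
        _ ≤ ∑ p ∈ P', ∑ b ∈ U with hit p b, w b :=
            Finset.sum_le_sum fun p hp => h p (Finset.mem_filter.1 hp).1
        _ = ∑ b ∈ U, w b * ((P'.filter fun p => hit p b).card : ℝ) := by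
            simp_rw [Finset.sum_filter]
            rw [Finset.sum_comm]
            refine Finset.sum_congr rfl fun b _ => ?_
            rw [← Finset.sum_filter, Finset.sum_const, nsmul_eq_mul, mul_comm]
    have hbP := le_of_mul_le_mul_left hbP (hw b hb)
    refine ⟨insert b Q, (Finset.card_insert_le _ _).trans (by omega), ?_⟩
    have hcard := Finset.card_filter_add_card_filter_not (s := P') (fun p => hit p b)
    have heq : (P.filter fun p => ∀ c ∈ insert b Q, ¬ hit p c) =
        P'.filter fun p => ¬ hit p b := by
      ext p
      simp only [hP', Finset.mem_filter, Finset.forall_mem_insert]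
      tauto
    rw [heq]
    have hcard' : ((P'.filter fun p => hit p b).card : ℝ) +
        ((P'.filter fun p => ¬ hit p b).card : ℝ) = P'.card := by exact_mod_cast hcard
    have : (1 - q) * (P'.card : ℝ) ≤ (1 - q) * ((1 - q) ^ k * P.card) :=
      mul_le_mul_of_nonneg_left hQ (by linarith)
    rw [pow_succ]
    linarith

/-! ### Weights of the sets of prescribed mass. -/

section Weight
variable {X : Type*}

/-- The total weight `∑ 4 ^ (-|A|)` of the subsets `A` of `S` of mass `v`. -/
noncomputable def splitWeight (w : X → ℝ) (S : Finset X) (v : ℝ) : ℝ :=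
  ∑ A ∈ S.powerset with ∑ x ∈ A, w x = v, (1 / 4 : ℝ) ^ A.card

theorem splitWeight_mono (w : X → ℝ) {S S' : Finset X} (h : S ⊆ S') (v : ℝ) :
    splitWeight w S v ≤ splitWeight w S' v :=
  Finset.sum_le_sum_of_subset_of_nonneg
    (Finset.filter_subset_filter _ (Finset.powerset_mono.2 h)) fun _ _ _ => by positivity

theorem splitWeight_nonneg (w : X → ℝ) (S : Finset X) (v : ℝ) : 0 ≤ splitWeight w S v :=
  Finset.sum_nonneg fun _ _ => by positivity

theorem le_splitWeight_of_const {w : X → ℝ} {S : Finset X} {a : ℝ} (hw : ∀ x ∈ S, w x = a)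
    (k : ℕ) : S.card.choose k * (1 / 4 : ℝ) ^ k ≤ splitWeight w S (k * a) := by
  unfold splitWeight
  rw [← Finset.card_powersetCard, ← nsmul_eq_mul, ← Finset.sum_const]
  calc ∑ _A ∈ Finset.powersetCard k S, (1 / 4 : ℝ) ^ k
      = ∑ A ∈ Finset.powersetCard k S, (1 / 4 : ℝ) ^ A.card :=
        Finset.sum_congr rfl fun A hA => by rw [(Finset.mem_powersetCard.1 hA).2]
    _ ≤ _ := by
      refine Finset.sum_le_sum_of_subset_of_nonneg (fun A hA => ?_) fun _ _ _ => by positivity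
      rw [Finset.mem_powersetCard] at hA
      rw [Finset.mem_filter, Finset.mem_powerset]
      refine ⟨hA.1, ?_⟩
      rw [Finset.sum_congr rfl fun x hx => hw x (hA.1 hx), Finset.sum_const, hA.2, nsmul_eq_mul]

/-- For `2 * k ≤ m` the central binomial coefficient bounds `m.choose k` from below. Beyond the
middle, symmetry reduces to `m - k`, and the excess `e` costs a factor `4 ^ e`. -/
theorem choose_mul_quarter_pow_le {m k e : ℕ} (hk : k ≤ m) (he : 2 * k ≤ m + e) :
    (1 / 4 : ℝ) ^ e / (m + 1) ≤ m.choose k * (1 / 4 : ℝ) ^ k := by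
  have key : ∀ l, 2 * l ≤ m → (4 : ℝ) ^ l ≤ (m + 1) * m.choose l := by
    intro l hl
    have h1 : 4 ^ l ≤ (2 * l + 1) * l.centralBinom :=
      Nat.four_pow_le_two_mul_add_one_mul_central_binom l
    have h2 : l.centralBinom ≤ m.choose l := Nat.choose_le_choose l hl
    have h3 : 4 ^ l ≤ (m + 1) * m.choose l :=
      h1.trans (Nat.mul_le_mul (by omega) h2)
    exact_mod_cast h3
  have h4 : (4 : ℝ) ^ k ≤ 4 ^ e * ((m + 1) * m.choose k) := by
    rcases le_total (2 * k) m with h | h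
    · refine (key k h).trans (le_mul_of_one_le_left (by positivity) (one_le_pow₀ (by norm_num)))
    · have := key (m - k) (by omega)
      rw [Nat.choose_symm hk] at this
      calc (4 : ℝ) ^ k ≤ 4 ^ (e + (m - k)) := pow_le_pow_right₀ (by norm_num) (by omega)
        _ = 4 ^ e * 4 ^ (m - k) := pow_add _ _ _
        _ ≤ _ := by gcongr
  rw [one_div, inv_pow, inv_pow, ← one_div, ← one_div, div_div, mul_one_div,
    div_le_div_iff₀ (by positivity) (by positivity)]
  linarith

variable [DecidableEq X]

/-- The weight is multiplicative over disjoint unions, and a union determines its two parts; this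
lets the selection proceed level by level. -/
theorem splitWeight_mul_le (w : X → ℝ) {S S' : Finset X} (h : Disjoint S S') (v v' : ℝ) :
    splitWeight w S v * splitWeight w S' v' ≤ splitWeight w (S ∪ S') (v + v') := by
  unfold splitWeight
  rw [Finset.sum_mul_sum, ← Finset.sum_product']
  have hinj : Set.InjOn (fun p : Finset X × Finset X => p.1 ∪ p.2)
      (((S.powerset.filter fun A => ∑ x ∈ A, w x = v) ×ˢ
        (S'.powerset.filter fun A => ∑ x ∈ A, w x = v') : Finset _) : Set _) := by
    rintro ⟨A, B⟩ hp ⟨A', B'⟩ hp' heq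
    simp only [Finset.coe_product, Set.mem_prod, Finset.mem_coe, Finset.mem_filter,
      Finset.mem_powerset] at hp hp'
    have inter : ∀ {C D : Finset X}, C ⊆ S → D ⊆ S' → (C ∪ D) ∩ S = C ∧ (C ∪ D) ∩ S' = D := by
      intro C D hC hD
      rw [Finset.union_inter_distrib_right, Finset.union_inter_distrib_right,
        Finset.inter_eq_left.2 hC, Finset.inter_eq_left.2 hD,
        Finset.disjoint_iff_inter_eq_empty.1 (h.symm.mono_left hD),
        Finset.disjoint_iff_inter_eq_empty.1 (h.mono_left hC)]
      simp
    have h1 := inter hp.1.1 hp.2.1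
    have h2 := inter hp'.1.1 hp'.2.1
    simp only at heq
    rw [heq] at h1
    exact Prod.ext (h1.1.symm.trans h2.1) (h1.2.symm.trans h2.2)
  have hdisj : ∀ {C D : Finset X}, C ⊆ S → D ⊆ S' → Disjoint C D :=
    fun hC hD => (h.mono_left hC).mono_right hD
  calc _ = ∑ p ∈ (S.powerset.filter fun A => ∑ x ∈ A, w x = v) ×ˢ
        (S'.powerset.filter fun A => ∑ x ∈ A, w x = v'), (1 / 4 : ℝ) ^ (p.1 ∪ p.2).card := by
        refine Finset.sum_congr rfl fun p hp => ?_
        simp only [Finset.mem_product, Finset.mem_filter, Finset.mem_powerset] at hp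
        rw [Finset.card_union_of_disjoint (hdisj hp.1.1 hp.2.1), pow_add]
    _ = ∑ A ∈ ((S.powerset.filter fun A => ∑ x ∈ A, w x = v) ×ˢ
        (S'.powerset.filter fun A => ∑ x ∈ A, w x = v')).image fun p => p.1 ∪ p.2,
        (1 / 4 : ℝ) ^ A.card :=
        (Finset.sum_image (f := fun A : Finset X => (1 / 4 : ℝ) ^ A.card) hinj).symm
    _ ≤ _ := by
      refine Finset.sum_le_sum_of_subset_of_nonneg ?_ fun _ _ _ => by positivity
      intro A hA
      obtain ⟨p, hp, rfl⟩ := Finset.mem_image.1 hA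
      simp only [Finset.mem_product, Finset.mem_filter, Finset.mem_powerset] at hp ⊢
      exact ⟨Finset.union_subset_union hp.1.1 hp.2.1, by
        rw [Finset.sum_union (hdisj hp.1.1 hp.2.1), hp.1.2, hp.2.2]⟩

end Weight

/-! ### Levels of the tree of a dyadic distribution. -/

/-- In a binary tree with `m j` leaves and `r j` internal nodes at depth `j`, some level near the
root has few internal nodes, and no more than the level above. -/
theorem exists_narrow_level {m r : ℕ → ℕ} {n R : ℕ} (hr0 : r 0 = 1)
    (hr : ∀ j, m (j + 1) + r (j + 1) = 2 * r j)
    (hm : ∀ J, ∑ j ∈ Finset.range J, m (j + 1) ≤ n) (hz : ∃ j, r (j + 1) = 0) (hn : n ≤ R * R) :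
    ∃ J ≤ 2 * R, r (J + 1) ≤ R ∧ r (J + 1) ≤ r J := by
  have htel : ∀ J, ∑ j ∈ Finset.range J, r j + 1 = ∑ j ∈ Finset.range J, m (j + 1) + r J := by
    intro J
    induction J with
    | zero => simp [hr0]
    | succ J ih =>
      have := hr J
      rw [Finset.sum_range_succ, Finset.sum_range_succ]
      omega
  have hex : ∃ J, r (J + 1) ≤ R ∧ r (J + 1) ≤ r J :=
    hz.imp fun J hJ => by omega
  obtain ⟨J, ⟨hJ1, hJ2⟩, hcon⟩ : ∃ J, (r (J + 1) ≤ R ∧ r (J + 1) ≤ r J) ∧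
      ∀ j < J, ¬ (r (j + 1) ≤ R ∧ r (j + 1) ≤ r j) :=
    ⟨Nat.find hex, Nat.find_spec hex, fun _ => Nat.find_min hex⟩
  refine ⟨J, ?_, hJ1, hJ2⟩
  -- Before the first narrow level, `r` either exceeds `R` or strictly increases. If `J` exceeded `2
  -- * R`, more than `R` levels would each have more than `R` internal nodes, too many for at most
  -- `R * R` leaves.
  have hlow : ∀ j ≤ J, R < r j ∨ j + 1 ≤ r j := by
    intro j
    induction j with
    | zero => intro _; right; omega
    | succ j ih =>
      intro hj
      have h1 := ih (by omega)
      have h2 := hcon j (by omega)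
      omega
  by_contra! hJ
  have h1 : (R + 1) * (R + 1) ≤ ∑ j ∈ Finset.range (J + 1), r j := by
    calc (R + 1) * (R + 1) ≤ ∑ _j ∈ Finset.Ico R (J + 1), (R + 1) := by
          rw [Finset.sum_const, Nat.card_Ico, smul_eq_mul]
          exact Nat.mul_le_mul_right _ (by omega)
      _ ≤ ∑ j ∈ Finset.Ico R (J + 1), r j := by
          refine Finset.sum_le_sum fun j hj => ?_
          rw [Finset.mem_Ico] at hj
          have := hlow j (by omega)
          omega
      _ ≤ _ := Finset.sum_le_sum_of_subset fun j hj => by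
          rw [Finset.mem_Ico] at hj
          exact Finset.mem_range.2 hj.2
  have h2 := htel (J + 1)
  have h3 := hm (J + 1)
  nlinarith

section Split
variable {X : Type}

theorem one_le_splitWeight_zero (w : X → ℝ) (S : Finset X) : 1 ≤ splitWeight w S 0 := by
  have h : ∅ ∈ S.powerset.filter fun A => ∑ x ∈ A, w x = 0 := by simp
  have := Finset.single_le_sum (f := fun A : Finset X => (1 / 4 : ℝ) ^ A.card)
    (fun _ _ => by positivity) h
  rwa [Finset.card_empty, pow_zero] at this

theorem disjoint_filter_le_succ (S : Finset X) (d : X → ℕ) (j : ℕ) :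
    Disjoint (S.filter (d · ≤ j)) (S.filter (d · = j + 1)) :=
  Finset.disjoint_filter.2 fun x _ h h' => by omega

variable [DecidableEq X]

theorem filter_le_succ (S : Finset X) (d : X → ℕ) (j : ℕ) :
    S.filter (d · ≤ j + 1) = S.filter (d · ≤ j) ∪ S.filter (d · = j + 1) := by
  rw [← Finset.filter_or]
  exact Finset.filter_congr fun x _ => by omega

/-- The numbers of internal nodes on the levels of the Huffman tree of a dyadic distribution. -/
theorem exists_internal_nodes {S : Finset X} {d : X → ℕ}
    (hd : ∑ x ∈ S, (1 / 2 : ℝ) ^ d x = 1) (hS : 1 < S.card) :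
    ∃ r : ℕ → ℕ, r 0 = 1 ∧ (∀ j, (S.filter (d · = j + 1)).card + r (j + 1) = 2 * r j) ∧
      ∃ j, r (j + 1) = 0 := by
  obtain ⟨r, hr0, hr⟩ : ∃ r : ℕ → ℕ, r 0 = 1 ∧
      ∀ j, r (j + 1) = 2 * r j - (S.filter (d · = j + 1)).card :=
    ⟨fun j => Nat.rec 1 (fun i a => 2 * a - (S.filter (d · = i + 1)).card) j, rfl, fun _ => rfl⟩
  have hlev : ∀ j, ∑ x ∈ S with d x = j + 1, (1 / 2 : ℝ) ^ d x =
      (S.filter (d · = j + 1)).card * (1 / 2 : ℝ) ^ (j + 1) := by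
    intro j
    rw [← nsmul_eq_mul, ← Finset.sum_const]
    exact Finset.sum_congr rfl fun x hx => by rw [(Finset.mem_filter.1 hx).2]
  have hle : ∀ j, ∑ x ∈ S with d x ≤ j, (1 / 2 : ℝ) ^ d x ≤ 1 := fun j =>
    (Finset.sum_le_sum_of_subset_of_nonneg (Finset.filter_subset _ _)
      fun _ _ _ => by positivity).trans_eq hd
  have hsucc : ∀ j, ∑ x ∈ S with d x ≤ j + 1, (1 / 2 : ℝ) ^ d x =
      ∑ x ∈ S with d x ≤ j, (1 / 2 : ℝ) ^ d x +
        (S.filter (d · = j + 1)).card * (1 / 2 : ℝ) ^ (j + 1) := fun j => by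
    rw [filter_le_succ, Finset.sum_union (disjoint_filter_le_succ S d j), hlev]
  -- The mass left below level `j` is `r j * 2 ^ (-j)`, so the leaves of the next level fit and the
  -- natural subtraction defining `r` never truncates.
  have step : ∀ j, (r j : ℝ) * (1 / 2) ^ j + ∑ x ∈ S with d x ≤ j, (1 / 2 : ℝ) ^ d x = 1 →
      (S.filter (d · = j + 1)).card ≤ 2 * r j := by
    intro j hj
    have h1 := hle (j + 1)
    rw [hsucc, pow_succ] at h1
    have hp : (0 : ℝ) < (1 / 2) ^ j := by positivity
    have h2 : ((S.filter (d · = j + 1)).card : ℝ) ≤ 2 * r j := by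
      refine le_of_mul_le_mul_right ?_ hp
      linarith
    exact_mod_cast h2
  have hmass : ∀ j, (r j : ℝ) * (1 / 2) ^ j + ∑ x ∈ S with d x ≤ j, (1 / 2 : ℝ) ^ d x = 1 := by
    intro j
    induction j with
    | zero =>
      have : S.filter (d · ≤ 0) = ∅ := Finset.filter_eq_empty_iff.2 fun x hx h =>
        exponent_ne_zero hd hS hx (by omega)
      rw [this, hr0]
      simp
    | succ j ih =>
      have h1 : ((S.filter (d · = j + 1)).card : ℝ) + r (j + 1) = 2 * r j := by
        have := step j ih
        exact_mod_cast (by rw [hr]; omega :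
          (S.filter (d · = j + 1)).card + r (j + 1) = 2 * r j)
      rw [hsucc, pow_succ]
      linear_combination (1 / 2 : ℝ) ^ j / 2 * h1 + ih
  refine ⟨r, hr0, fun j => ?_, S.sup d, ?_⟩
  · have := step j (hmass j)
    rw [hr]
    omega
  · have h1 := hmass (S.sup d + 1)
    rw [Finset.filter_true_of_mem fun x hx => (Finset.le_sup hx).trans (Nat.le_succ _), hd] at h1
    have h2 : (r (S.sup d + 1) : ℝ) * (1 / 2) ^ (S.sup d + 1) = 0 := by linarith
    have h3 := (mul_eq_zero.1 h2).resolve_right (by positivity)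
    exact_mod_cast h3

theorem splitWeight_filter_le_succ {S : Finset X} {d : X → ℕ} {n : ℕ} (hn : S.card ≤ n)
    (j : ℕ) {k e : ℕ} (hk : k ≤ (S.filter (d · = j + 1)).card)
    (he : 2 * k ≤ (S.filter (d · = j + 1)).card + e) (v : ℝ) :
    splitWeight (fun x => (1 / 2 : ℝ) ^ d x) (S.filter (d · ≤ j)) v * ((1 / 4) ^ e / (n + 1)) ≤
      splitWeight (fun x => (1 / 2 : ℝ) ^ d x) (S.filter (d · ≤ j + 1))
        (v + k * (1 / 2) ^ (j + 1)) := by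
  rw [filter_le_succ]
  refine le_trans ?_ (splitWeight_mul_le _ (disjoint_filter_le_succ S d j) _ _)
  refine mul_le_mul_of_nonneg_left ?_ (splitWeight_nonneg _ _ _)
  refine le_trans ?_ (le_splitWeight_of_const
    (fun x hx => by rw [(Finset.mem_filter.1 hx).2]) k)
  refine le_trans ?_ (choose_mul_quarter_pow_le hk he)
  have : ((S.filter (d · = j + 1)).card : ℝ) ≤ n := by
    exact_mod_cast (Finset.card_filter_le _ _).trans hn
  gcongr

/-- The weight of the sets that split a dyadic distribution is subexponentially small. -/
theorem le_splitWeight_half {S : Finset X} {d : X → ℕ}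
    (hd : ∑ x ∈ S, (1 / 2 : ℝ) ^ d x = 1) (hS : 1 < S.card) {n R : ℕ} (hn : S.card ≤ n)
    (hR : n ≤ R * R) :
    (1 / (4 * (n + 1)) : ℝ) ^ (3 * R + 1) ≤
      splitWeight (fun x => (1 / 2 : ℝ) ^ d x) S (1 / 2) := by
  obtain ⟨r, hr0, hr, hz⟩ := exists_internal_nodes hd hS
  have hm : ∀ J, ∑ j ∈ Finset.range J, (S.filter (d · = j + 1)).card ≤ n := by
    intro J
    rw [← Finset.card_biUnion fun i _ j _ hij =>
      Finset.disjoint_filter.2 fun x _ h h' => hij (by omega)]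
    exact (Finset.card_le_card (Finset.biUnion_subset.2 fun j _ =>
      Finset.filter_subset _ _)).trans hn
  obtain ⟨J, hJ, hJR, hJr⟩ :=
    exists_narrow_level (m := fun j => (S.filter (d · = j)).card) hr0 hr hm hz hR
  set c : ℝ := 1 / (4 * (n + 1)) with hc
  have hc0 : 0 < c := by positivity
  have hc4 : c ≤ 1 / 4 := by
    rw [hc]
    gcongr
    have : (0 : ℝ) ≤ n := by positivity
    linarith
  have hcn : c ≤ 1 / (n + 1) := by
    rw [hc]
    gcongr
    have : (0 : ℝ) ≤ n := by positivity
    linarith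
  -- In units of `2 ^ (-j)`, `e` is the surplus of selected over rejected leaf mass down to level
  -- `j`. The bound `e ≤ r j` says that the selected mass is at most 1/2.
  have balanced : ∀ j, ∃ e : ℕ, e ≤ r j ∧ (j = 0 ∨ e % 2 = r j % 2) ∧
      c ^ j ≤ splitWeight (fun x => (1 / 2 : ℝ) ^ d x) (S.filter (d · ≤ j))
        ((1 + ((e : ℝ) - r j) * (1 / 2) ^ j) / 2) := by
    intro j
    induction j with
    | zero =>
      refine ⟨0, Nat.zero_le _, Or.inl rfl, ?_⟩
      simpa [hr0] using one_le_splitWeight_zero _ _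
    | succ j ih =>
      obtain ⟨e, her, -, hw⟩ := ih
      have hrj := hr j
      set m := (S.filter (d · = j + 1)).card with hmdef
      -- The subtraction truncates on purpose. If `k` is `0` there, the new surplus `2 * e - m` is
      -- at most `2 * r j - m = r (j + 1)`; otherwise it is the parity of `m`, which is also that of
      -- `r (j + 1)`.
      obtain ⟨k, hk⟩ : ∃ k, k = (m + 1) / 2 - e := ⟨_, rfl⟩
      obtain ⟨e', he'⟩ : ∃ e', e' + m = 2 * e + 2 * k :=
        ⟨2 * e + 2 * k - m, by omega⟩
      refine ⟨e', by omega, Or.inr (by omega), ?_⟩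
      have h1 := splitWeight_filter_le_succ (d := d) hn j (k := k) (e := 1) (by omega) (by omega)
        ((1 + ((e : ℝ) - r j) * (1 / 2) ^ j) / 2)
      have hv : (1 + ((e : ℝ) - r j) * (1 / 2) ^ j) / 2 + k * (1 / 2) ^ (j + 1) =
          (1 + ((e' : ℝ) - r (j + 1)) * (1 / 2) ^ (j + 1)) / 2 := by
        have h2 : (m : ℝ) + r (j + 1) = 2 * r j := by exact_mod_cast hrj
        have h3 : (e' : ℝ) + m = 2 * e + 2 * k := by exact_mod_cast he'
        rw [pow_succ]
        linear_combination (1 / 2 : ℝ) ^ j / 4 * h2 - (1 / 2 : ℝ) ^ j / 4 * h3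
      rw [hv] at h1
      refine le_trans ?_ h1
      rw [pow_succ]
      have : c = (1 / 4) ^ 1 / (n + 1) := by rw [hc, pow_one, div_div]
      rw [← this]
      exact mul_le_mul_of_nonneg_right hw hc0.le
  obtain ⟨e, her, -, hw⟩ := balanced J
  have hrJ := hr J
  -- Exactly `r J - e` leaves of level `J + 1` are missing. That level has `2 * r J - r (J + 1) ≥ r
  -- J` leaves, and the excess over half of them costs at most `4 ^ R` because `r (J + 1) ≤ R`.
  have h1 := splitWeight_filter_le_succ (d := d) hn J (k := r J - e) (e := R)
    (by omega) (by omega) ((1 + ((e : ℝ) - r J) * (1 / 2) ^ J) / 2)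
  have hv : (1 + ((e : ℝ) - r J) * (1 / 2) ^ J) / 2 + (r J - e : ℕ) * (1 / 2) ^ (J + 1) =
      1 / 2 := by
    rw [Nat.cast_sub her, pow_succ]
    ring
  rw [hv] at h1
  refine le_trans ?_ (h1.trans (splitWeight_mono _ (Finset.filter_subset _ _) _))
  calc c ^ (3 * R + 1) ≤ c ^ (J + (R + 1)) :=
        pow_le_pow_of_le_one hc0.le (hc4.trans (by norm_num)) (by omega)
    _ = c ^ J * (c ^ R * c) := by rw [pow_add, pow_succ c R]
    _ ≤ _ := by
      refine mul_le_mul hw ?_ (by positivity) (splitWeight_nonneg _ _ _)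
      rw [div_eq_mul_one_div]
      gcongr

end Split

/-! ### Counting dyadic distributions and building the hitter. -/

section Count
variable {X : Type} [Fintype X]

theorem sum_quarter_pow_card :
    ∑ A : Finset X, (1 / 4 : ℝ) ^ A.card = (5 / 4) ^ Fintype.card X := by
  have h := Finset.sum_pow_mul_eq_add_pow (1 / 4 : ℝ) 1 (Finset.univ : Finset X)
  simp only [one_pow, mul_one, Finset.powerset_univ, Finset.card_univ] at h
  rw [h]
  norm_num

variable [DecidableEq X]

theorem splitWeight_le_sum_hit (S : Finset X) (w : X → ℝ) (v : ℝ) :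
    splitWeight w S v ≤
      ∑ A : Finset X with ∑ x ∈ S with x ∈ A, w x = v, (1 / 4 : ℝ) ^ A.card := by
  refine Finset.sum_le_sum_of_subset_of_nonneg (fun A hA => ?_) fun _ _ _ => by positivity
  rw [Finset.mem_filter, Finset.mem_powerset] at hA
  rw [Finset.mem_filter, Finset.filter_mem_eq_inter, Finset.inter_eq_right.2 hA.1]
  exact ⟨Finset.mem_univ _, hA.2⟩

/-- There are dyadic hitters with `1.25 ^ (n + o(n))` questions. -/
theorem exists_isDyadicHitter :
    ∃ Q : Finset (Finset X), IsDyadicHitter Q (Fintype.card X) ∧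
      (Q.card : ℝ) ≤ (5 / 4) ^ Fintype.card X *
        (4 * (Fintype.card X + 1)) ^ (3 * Nat.sqrt (Fintype.card X) + 6) := by
  set n := Fintype.card X with hn
  set R := Nat.sqrt n + 1 with hRdef
  have hR : n ≤ R * R := (Nat.lt_succ_sqrt n).le
  set B : ℝ := 4 * (n + 1) with hB
  have hn0 : (0 : ℝ) ≤ n := by positivity
  have hB1 : 1 ≤ B := by rw [hB]; linarith
  set D : ℝ := (5 / 4) ^ n * B ^ (3 * R + 1) with hD
  have hD1 : 1 ≤ D := one_le_mul_of_one_le_of_one_le (one_le_pow₀ (by norm_num)) (one_le_pow₀ hB1)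
  have hD0 : 0 < D := by linarith
  -- Exponents below `n` suffice, which makes the family of targets finite.
  let P : Finset (Finset X × (X → Fin n)) := Finset.univ.filter fun p =>
    ∑ x ∈ p.1, (1 / 2 : ℝ) ^ (p.2 x : ℕ) = 1 ∧ 1 < p.1.card
  have hPcard : (P.card : ℝ) < Real.exp (2 * n ^ 2 + 1) := by
    have h1 : P.card ≤ 2 ^ n * n ^ n := by
      refine (Finset.card_le_univ P).trans_eq ?_
      simp [hn]
    have h2 : (P.card : ℝ) ≤ (2 * n) ^ n := by
      rw [mul_pow]
      exact_mod_cast h1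
    have h3 : (2 * n : ℝ) ≤ Real.exp (2 * n) := by
      have := Real.add_one_le_exp (2 * n : ℝ)
      linarith
    calc (P.card : ℝ) ≤ (2 * n) ^ n := h2
      _ ≤ Real.exp (2 * n) ^ n := by gcongr
      _ = Real.exp (2 * n ^ 2) := by rw [← Real.exp_nat_mul]; ring_nf
      _ < _ := Real.exp_lt_exp.2 (by linarith)
  -- Each target is hit by a proportion at least `1 / D` of the weight, so after `k` choices fewer
  -- than `exp (-(2 * n ^ 2 + 1)) * exp (2 * n ^ 2 + 1) = 1` targets remain.
  set k := ⌈(2 * n ^ 2 + 1) * D⌉₊ with hk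
  obtain ⟨Q, hQk, hQ⟩ := exists_cover (Finset.univ : Finset (Finset X)) Finset.univ_nonempty
    (fun A => (1 / 4 : ℝ) ^ A.card) (fun _ _ => by positivity) P
    (fun p A => ∑ x ∈ p.1 with x ∈ A, (1 / 2 : ℝ) ^ (p.2 x : ℕ) = 1 / 2)
    (q := 1 / D) ((div_le_one hD0).2 hD1) (by
      intro p hp
      obtain ⟨-, hp1, hp2⟩ := Finset.mem_filter.1 hp
      refine le_trans ?_ (splitWeight_le_sum_hit p.1 _ _)
      refine le_trans (le_of_eq ?_) (le_splitWeight_half hp1 hp2 (Finset.card_le_univ _) hR)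
      rw [sum_quarter_pow_card, hD, ← hn, ← hB, one_div_pow]
      field_simp) k
  have hlt : (1 - 1 / D) ^ k * (P.card : ℝ) < 1 := by
    have h1 : (1 - 1 / D) ^ k ≤ Real.exp (-(2 * n ^ 2 + 1)) := by
      calc (1 - 1 / D) ^ k ≤ Real.exp (-(1 / D)) ^ k := by
            refine pow_le_pow_left₀ (sub_nonneg.2 ((div_le_one hD0).2 hD1)) ?_ _
            exact Real.one_sub_le_exp_neg _
        _ = Real.exp (-(k / D)) := by rw [← Real.exp_nat_mul]; ring_nf
        _ ≤ _ := by
            refine Real.exp_le_exp.2 (neg_le_neg ?_)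
            rw [le_div_iff₀ hD0]
            exact Nat.le_ceil _
    calc (1 - 1 / D) ^ k * (P.card : ℝ) ≤ Real.exp (-(2 * n ^ 2 + 1)) * P.card := by gcongr
      _ < Real.exp (-(2 * n ^ 2 + 1)) * Real.exp (2 * n ^ 2 + 1) := by gcongr
      _ = 1 := by rw [← Real.exp_add, neg_add_cancel, Real.exp_zero]
  have hempty : (P.filter fun p => ∀ A ∈ Q,
      ¬ ∑ x ∈ p.1 with x ∈ A, (1 / 2 : ℝ) ^ (p.2 x : ℕ) = 1 / 2) = ∅ := by
    rw [← Finset.card_eq_zero, ← Nat.lt_one_iff]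
    exact_mod_cast hQ.trans_lt hlt
  refine ⟨Q, ?_, ?_⟩
  · intro S d hdN hd hS
    obtain ⟨x₀, hx₀⟩ := Finset.card_pos.1 (zero_lt_one.trans hS)
    have hpos : 0 < n := (Nat.zero_le _).trans_lt (hdN x₀ hx₀)
    -- Only the exponents on `S` matter; the value `0` elsewhere is a filler.
    let g : X → Fin n := fun x => if h : d x < n then ⟨d x, h⟩ else ⟨0, hpos⟩
    have hg : ∀ x ∈ S, (g x : ℕ) = d x := fun x hx => by simp [g, hdN x hx]
    have hp : (S, g) ∈ P := by
      refine Finset.mem_filter.2 ⟨Finset.mem_univ _, Eq.trans ?_ hd, hS⟩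
      exact Finset.sum_congr rfl fun x hx => by rw [hg x hx]
    have := Finset.filter_eq_empty_iff.1 hempty hp
    push Not at this
    obtain ⟨A, hA, hs⟩ := this
    refine ⟨A, hA, Eq.trans ?_ hs⟩
    exact Finset.sum_congr rfl fun x hx => by rw [hg x (Finset.mem_filter.1 hx).1]
  · have h1 : (k : ℝ) ≤ (2 * n ^ 2 + 1) * D + 1 := (Nat.ceil_lt_add_one (by positivity)).le
    calc (Q.card : ℝ) ≤ k := by exact_mod_cast hQk
      _ ≤ (2 * n ^ 2 + 2) * D := by linarith
      _ ≤ B ^ 2 * D := by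
          gcongr
          rw [hB]
          nlinarith
      _ = _ := by
          rw [hD, hRdef]
          ring

end Count

/-! ### The error term and the conclusion. -/

open Filter Asymptotics in
theorem isLittleO_sqrt_mul_log :
    (fun n : ℕ => ((3 * Nat.sqrt n + 6 : ℕ) : ℝ) * Real.log (4 * (n + 1)) / Real.log 1.25)
      =o[atTop] fun n : ℕ => (n : ℝ) := by
  have h1 : (fun n : ℕ => ((3 * Nat.sqrt n + 6 : ℕ) : ℝ)) =O[atTop] fun n : ℕ => √(n : ℝ) := by
    refine IsBigO.of_bound 9 ?_
    filter_upwards [eventually_ge_atTop 1] with n hn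
    have h : (1 : ℝ) ≤ √n := Real.one_le_sqrt.2 (by exact_mod_cast hn)
    have h' : (Nat.sqrt n : ℝ) ≤ √n := Real.nat_sqrt_le_real_sqrt
    rw [Real.norm_of_nonneg (by positivity), Real.norm_of_nonneg (by positivity)]
    push_cast
    linarith
  have h2 : (fun n : ℕ => Real.log (4 * (n + 1))) =o[atTop] fun n : ℕ => √(n : ℝ) := by
    have htop : Tendsto (fun n : ℕ => (4 * (n + 1) : ℝ)) atTop atTop :=
      (tendsto_atTop_add_const_right _ _ tendsto_natCast_atTop_atTop).const_mul_atTop (by norm_num)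
    refine ((isLittleO_log_rpow_atTop (r := 1 / 2) (by norm_num)).comp_tendsto htop).trans_isBigO ?_
    refine IsBigO.of_bound 3 ?_
    filter_upwards [eventually_ge_atTop 1] with n hn
    have hn' : (1 : ℝ) ≤ n := by exact_mod_cast hn
    rw [Function.comp_apply, ← Real.sqrt_eq_rpow, Real.norm_of_nonneg (by positivity),
      Real.norm_of_nonneg (by positivity)]
    rw [Real.sqrt_le_left (by positivity), mul_pow, Real.sq_sqrt (by positivity)]
    linarith
  have h3 := (h1.mul_isLittleO h2).const_mul_left (Real.log 1.25)⁻¹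
  refine (h3.congr (fun n => ?_) fun n => ?_)
  · rw [div_eq_inv_mul]
  · exact Real.mul_self_sqrt (by positivity)

end TwentyQuestions

theorem mainTheorem3 :
    ∃ f : ℕ → ℝ, Asymptotics.IsLittleO Filter.atTop f (fun n : ℕ => (n : ℝ)) ∧
      ∀ n : ℕ,
        (TwentyQuestions.uHuf n 0 : ℝ) ≤ (1.25 : ℝ) ^ ((n : ℝ) + f n) ∧
        ∃ Q : Finset (Finset (Fin n)),
          (Q.card : ℝ) ≤ (1.25 : ℝ) ^ ((n : ℝ) + f n) ∧
          ∀ μ ∈ stdSimplex ℝ (Fin n),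
            ∃ T : TwentyQuestions.DecisionTree (Fin n),
              T.Uses Q ∧ T.Valid μ ∧
                ((T.cost μ : ℝ) : EReal) = TwentyQuestions.opt μ := by
  -- The function `f` is the base-1.25 logarithm of the subexponential factor in
  -- `exists_isDyadicHitter`.
  refine ⟨_, TwentyQuestions.isLittleO_sqrt_mul_log, fun n => ?_⟩
  obtain ⟨Q, hQ, hcard⟩ := TwentyQuestions.exists_isDyadicHitter (X := Fin n)
  have hbound : (Q.card : ℝ) ≤ (1.25 : ℝ) ^ ((n : ℝ) +
      ((3 * Nat.sqrt n + 6 : ℕ) : ℝ) * Real.log (4 * (n + 1)) / Real.log 1.25) := by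
    refine hcard.trans_eq ?_
    rw [Fintype.card_fin, Real.rpow_add (by norm_num), Real.rpow_natCast]
    congr 1
    · norm_num
    · have hlog : Real.log 1.25 ≠ 0 := (Real.log_pos (by norm_num)).ne'
      rw [Real.rpow_def_of_pos (by norm_num), mul_div_cancel₀ _ hlog, Real.exp_nat_mul,
        Real.exp_log (by positivity)]
  refine ⟨le_trans ?_ hbound, Q, hbound, fun μ hμ => hQ.exists_optimal hμ⟩
  have hmem : Q.card ∈ {k : ℕ | ∃ Q : Finset (Finset (Fin n)), Q.card = k ∧
      TwentyQuestions.prolixity Q ≤ ((0 : ℝ) : EReal)} :=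
    ⟨Q, rfl, by simpa using hQ.prolixity_nonpos⟩
  exact_mod_cast Nat.sInf_le hmem
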